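/- Let $N\ge 0$ and let $A_I^0,A_O^0,A_I^1,\dots,A_O^{N-1},A_I^N$ be nonzero finite-dimensional Hilbert spaces with fixed orthonormal bases (sites $0,\dots,N$; the last site has only an input space). Choi matrices are $T=\sum_{a,b}|a\rangle\langle b|\otimes\mathcal T(|a\rangle\langle b|)$. **Classical-memory processes.** A *classical-memory datum* consists of finite nonempty sets of settings $S_0,\dots,S_N$ and of outcomes $M_1,\dots,M_N$, a probability distribution $p(s_0)$ and density matrices $\rho_{s_0}$ on $A_I^0$, conditional distributions $p(s_n\mid s_0,\dots,s_{n-1},m_1,\dots,m_{n-1})$ on $S_n$, and for each $s_n\in S_n$ a quantum instrument $\{T^n_{m_n|s_n}\}_{m_n\in M_n}$ from $A_O^{n-1}$ to $A_I^n$ (Choi matrices $T^n_{m|s}\ge 0$ with $\mathrm{Tr}_{A_I^n}\sum_m T^n_{m|s}=\mathbb 1$), $1\le n\le N$. Its process matrix is $$W_{\rm CM}=\sum_{\vec s,\vec m}p(s_0)\,\rho_{s_0}\otimes\bigotimes_{n=1}^{N}p(s_n\mid s_0,\dots,s_{n-1},m_1,\dots,m_{n-1})\,T^n_{m_n|s_n}.$$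 **Circuits of nested controlled unitaries.** Such a circuit has environment registers with fixed orthonormal bases labelled by finite sets: $S_0$ and, for $1\le n\le N$, $S_n$, $M_n$, $K_n$, with $S_n, M_n$ nonempty. It starts in an arbitrary density matrix on $A_I^0\otimes\mathbb C^{S_0}$. At step $n$ fresh registers $\mathbb C^{S_n}$ and $\mathbb C^{X_n}$ are supplied in basis states $|0\rangle$; then, with $h=(s_0,s_1,m_1,\dots,s_{n-1},m_{n-1})$ running over the basis labels of the earlier $S$- and $M$-registers, one applies the controlled rotation $\sum_h|h\rangle\langle h|\otimes R^n_h$ with unitaries $R^n_h$ on $\mathbb C^{S_n}$, followed by the controlled unitary $\sum_{h,s}|h,s\rangle\langle h,s|\otimes U^n_{h,s}$ with unitaries $U^n_{h,s}:A_O^{n-1}\otimes\mathbb C^{X_n}\to A_I^n\otimes\mathbb C^{M_n}\otimes\mathbb C^{K_n}$. After the preparation and after every step, any (possibly trivial or degenerate) projective measurement of the environment that is diagonal in the fixed basis may be made, its result being forgotten. The process matrix of the circuit is the link product of the initial state, the fresh registers and the Choi matrices of the steps (with the measurements inserted), with the environment traced out at the end. **Claim.** 1. An operator $W$ on $A_I^0\otimes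 A_O^0\otimes\cdots\otimes A_I^N$ is the process matrix of some classical-memory datum if and only if it is the process matrix of some circuit of nested controlled unitaries with some choice of measurements. 2. More precisely, for every classical-memory datum there are registers $K_n,X_n$ and a circuit on the registers $S_n,M_n,K_n,X_n$ with initial state $\sum_{s}p(s)\rho_s\otimes|s\rangle\langle s|$, with $R^n_h|0\rangle=\sum_{s}\sqrt{p(s\mid h)}\,|s\rangle$, with $U^n_{h,s}=U^n_s$ depending only on $s$, and with $T^n_{m|s}$ being the Choi matrix of $\sigma\mapsto\mathrm{Tr}_{M_nK_n}\big[(\mathbb 1\otimes|m\rangle\langle m|_{M_n})\,U^n_s(\sigma\otimes|0\rangle\langle 0|)U_s^{n\dagger}\big]$, whose process matrix is the $W_{\rm CM}$ of the datum, whichever of the above measurements on the environment are made (in particular if none is made). 3. In every such circuit the total system-environment operator of each step (controlled rotation followed by controlled unitary) is unitary. -/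

import Mathlib

open scoped ComplexOrder Kronecker

namespace ClassicalMemoryProcess

/-! ### Sites

Sites and gates are numbered from `0`.  Site `n` has the input Hilbert space `ℂ^(I n)` and the output
Hilbert space `ℂ^(O n)`.  A process with `N` gates has the sites `0, …, N`; gate `n` sits between the
output of site `n` and the input of site `n + 1`, and the last site `N` has an input space only.
Only `I 0, …, I N` and `O 0, …, O (N - 1)` enter. -/

/-- Basis labels of `I₀ ⊗ (O₀ ⊗ I₁) ⊗ ⋯ ⊗ (Oₙ₋₁ ⊗ Iₙ)`, the space of process matrices with `n`
gates. -/
def Sites (I O : ℕ → Type) : ℕ → Type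
  | 0 => I 0
  | n + 1 => Sites I O n × (O n × I (n + 1))

/-- Classical records `(s₀, s₁, m₁, …, sₙ, mₙ)` of settings and outcomes. (`M 0` is not used.) -/
def Hist (S M : ℕ → Type) : ℕ → Type
  | 0 => S 0
  | n + 1 => Hist S M n × (S (n + 1) × M (n + 1))

instance Hist.instFintype (S M : ℕ → Type) [∀ n, Fintype (S n)] [∀ n, Fintype (M n)] :
    ∀ n, Fintype (Hist S M n)
  | 0 => inferInstanceAs (Fintype (S 0))
  | n + 1 =>
    haveI := Hist.instFintype S M n
    inferInstanceAs (Fintype (Hist S M n × (S (n + 1) × M (n + 1))))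

/-! ### Processes with classical memory -/

open scoped Classical in
/-- The data of a classical-memory process with `N` gates: an ensemble of initial states,
instruments (given by the Choi matrices of their completely positive maps `O n → I (n + 1)`), and
the conditional probabilities `p(sₙ₊₁ | s₀, s₁, m₁, …, sₙ, mₙ)` with which the settings are chosen. -/
structure ClassicalMemory (I O S M : ℕ → Type) [∀ n, Fintype (I n)] [∀ n, Fintype (O n)]
    [∀ n, Fintype (S n)] [∀ n, Fintype (M n)] (N : ℕ) where
  /-- the distribution `p(s₀)` -/
  p₀ : S 0 → ℝ
  p₀_nonneg : ∀ s, 0 ≤ p₀ s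
  p₀_sum : ∑ s, p₀ s = 1
  /-- the initial states `ρ_{s₀}` -/
  ρ : S 0 → Matrix (I 0) (I 0) ℂ
  ρ_posSemidef : ∀ s, (ρ s).PosSemidef
  ρ_trace : ∀ s, (ρ s).trace = 1
  /-- the conditional distributions of the next setting given the record so far -/
  p : ∀ n, Hist S M n → S (n + 1) → ℝ
  p_nonneg : ∀ n < N, ∀ h s, 0 ≤ p n h s
  p_sum : ∀ n < N, ∀ h, ∑ s, p n h s = 1
  /-- `T n s m`: Choi matrix of the map of outcome `m` of the instrument with setting `s` -/
  T : ∀ n, S (n + 1) → M (n + 1) → Matrix (O n × I (n + 1)) (O n × I (n + 1)) ℂ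
  T_posSemidef : ∀ n < N, ∀ s m, (T n s m).PosSemidef
  /-- the maps of an instrument sum to a trace-preserving one: `Tr_I ∑ₘ T n s m = 1` on `O n` -/
  T_tracePreserving : ∀ n < N, ∀ s, ∀ o o' : O n,
    ∑ m, ∑ i, T n s m (o, i) (o', i) = if o = o' then 1 else 0

namespace ClassicalMemory

variable {I O S M : ℕ → Type} [∀ n, Fintype (I n)] [∀ n, Fintype (O n)]
  [∀ n, Fintype (S n)] [∀ n, Fintype (M n)] {N : ℕ}

/-- The summand
`p(s₀) ρ_{s₀} ⊗ p(s₁|s₀) T_{m₁|s₁} ⊗ ⋯ ⊗ p(sₙ|s₀,…,sₙ₋₁,m₁,…,mₙ₋₁) T_{mₙ|sₙ}` of a record. -/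
noncomputable def term (D : ClassicalMemory I O S M N) :
    ∀ n, Hist S M n → Matrix (Sites I O n) (Sites I O n) ℂ
  | 0, s => (D.p₀ s : ℂ) • D.ρ s
  | n + 1, (h, s, m) => D.term n h ⊗ₖ ((D.p n h s : ℂ) • D.T n s m)

/-- The process matrix `W_CM`: the sum over all settings and outcomes. -/
noncomputable def processMatrix (D : ClassicalMemory I O S M N) :
    Matrix (Sites I O N) (Sites I O N) ℂ :=
  ∑ h : Hist S M N, D.term N h

end ClassicalMemory

/-- `W` is a process matrix with `N` gates and classical memory. -/
def IsClassicalMemory (I O : ℕ → Type) [∀ n, Fintype (I n)] [∀ n, Fintype (O n)] (N : ℕ)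
    (W : Matrix (Sites I O N) (Sites I O N) ℂ) : Prop :=
  ∃ (S M : ℕ → Type) (_ : ∀ n, Fintype (S n)) (_ : ∀ n, Fintype (M n))
    (_ : ∀ n, Nonempty (S n)) (_ : ∀ n, Nonempty (M n)) (D : ClassicalMemory I O S M N),
    D.processMatrix = W

/-! ### Choi matrices, link product, measurements -/

/-- `|V⟫⟪V|` for `V : ℂ^A → ℂ^B`, where `|V⟫ = ∑ₐ |a⟩ ⊗ V|a⟩`. -/
def choi {A B : Type} (V : Matrix B A ℂ) : Matrix (A × B) (A × B) ℂ :=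
  Matrix.of fun x y => V x.2 x.1 * star (V y.2 y.1)

/-- The link product `P * Q = Tr_E[(P^{T_E} ⊗ 1_B)(1_A ⊗ Q)]` over the shared space `E`, in
coordinates. -/
def link {A E B : Type} [Fintype E] (P : Matrix (A × E) (A × E) ℂ)
    (Q : Matrix (E × B) (E × B) ℂ) : Matrix (A × B) (A × B) ℂ :=
  Matrix.of fun x y => ∑ e, ∑ f, P (x.1, e) (y.1, f) * Q (e, x.2) (f, y.2)

open scoped Classical in
/-- Projective measurement of `E` in the fixed basis, with the result forgotten:
`P ↦ ∑_q (1 ⊗ Π_q) P (1 ⊗ Π_q)`, where `q` runs through the classes of `r` and `Π_q` is the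
projection on the span of the basis vectors in `q`. If all basis vectors are equivalent, nothing is
measured. -/
noncomputable def measure {A E : Type} (r : Setoid E) (P : Matrix (A × E) (A × E) ℂ) :
    Matrix (A × E) (A × E) ℂ :=
  Matrix.of fun x y => if r x.2 y.2 then P x y else 0

/-! ### Circuits of nested controlled unitaries -/

/-- Basis labels of the environment after `n` gates: a control register `S 0`, and for each gate
`k = 1, …, n` a control register `S k`, an outcome register `M k`, and a register `K k` that is not
used again. -/
def Env (S M K : ℕ → Type) : ℕ → Type
  | 0 => S 0
  | n + 1 => Env S M K n × (S (n + 1) × (M (n + 1) × K (n + 1)))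

instance Env.instFintype (S M K : ℕ → Type) [∀ n, Fintype (S n)] [∀ n, Fintype (M n)]
    [∀ n, Fintype (K n)] : ∀ n, Fintype (Env S M K n)
  | 0 => inferInstanceAs (Fintype (S 0))
  | n + 1 =>
    haveI := Env.instFintype S M K n
    inferInstanceAs (Fintype (Env S M K n × (S (n + 1) × (M (n + 1) × K (n + 1)))))

/-- The part of an environment basis label that later gates may be controlled by. -/
def Env.hist {S M K : ℕ → Type} : ∀ {n}, Env S M K n → Hist S M n
  | 0, s => s
  | _ + 1, (e, s, m, _) => (Env.hist e, s, m)

open scoped Classical in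
/-- A circuit with `N` gates. It starts in an arbitrary joint state of the system and the register
`S 0`. At gate `n` two fresh environment registers `S (n + 1)` and `X (n + 1)` are supplied in the
basis states `zS n` and `zX n`; first `S (n + 1)` is rotated by `R n h`, controlled by the basis state
`h` of the earlier control and outcome registers; then `U n h s`, controlled by `h` and by the basis
state `s` of `S (n + 1)`, acts on the system and `X (n + 1)`, whose space is split into `M (n + 1)` and
`K (n + 1)` afterwards. -/
structure Circuit (I O S M K X : ℕ → Type) [∀ n, Fintype (I n)] [∀ n, Fintype (O n)]
    [∀ n, Fintype (S n)] [∀ n, Fintype (M n)] [∀ n, Fintype (K n)] [∀ n, Fintype (X n)]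
    (N : ℕ) where
  init : Matrix (I 0 × S 0) (I 0 × S 0) ℂ
  init_posSemidef : init.PosSemidef
  init_trace : init.trace = 1
  zS : ∀ n, S (n + 1)
  zX : ∀ n, X (n + 1)
  R : ∀ n, Hist S M n → Matrix (S (n + 1)) (S (n + 1)) ℂ
  R_isometry : ∀ n < N, ∀ h, (R n h).conjTranspose * R n h = 1
  R_coisometry : ∀ n < N, ∀ h, R n h * (R n h).conjTranspose = 1
  U : ∀ n, Hist S M n → S (n + 1) →
    Matrix (I (n + 1) × (M (n + 1) × K (n + 1))) (O n × X (n + 1)) ℂ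
  U_isometry : ∀ n < N, ∀ h s, (U n h s).conjTranspose * U n h s = 1
  U_coisometry : ∀ n < N, ∀ h s, U n h s * (U n h s).conjTranspose = 1

namespace Circuit

variable {I O S M K X : ℕ → Type} [∀ n, Fintype (I n)] [∀ n, Fintype (O n)]
  [∀ n, Fintype (S n)] [∀ n, Fintype (M n)] [∀ n, Fintype (K n)] [∀ n, Fintype (X n)] {N : ℕ}

open scoped Classical in
/-- `∑ₑ |e⟩⟨e| ⊗ R n (hist e)` on the old environment and the fresh register `S (n + 1)`. -/
noncomputable def controlledRotation (C : Circuit I O S M K X N) (n : ℕ) :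
    Matrix (Env S M K n × S (n + 1)) (Env S M K n × S (n + 1)) ℂ :=
  (Matrix.blockDiagonal fun e : Env S M K n => C.R n e.hist).submatrix Prod.swap Prod.swap

open scoped Classical in
/-- `∑_{e,s} U n (hist e) s ⊗ |e,s⟩⟨e,s|`. -/
noncomputable def controlledUnitary (C : Circuit I O S M K X N) (n : ℕ) :
    Matrix ((I (n + 1) × (M (n + 1) × K (n + 1))) × (Env S M K n × S (n + 1)))
      ((O n × X (n + 1)) × (Env S M K n × S (n + 1))) ℂ :=
  Matrix.blockDiagonal fun c : Env S M K n × S (n + 1) => C.U n c.1.hist c.2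

open scoped Classical in
/-- The whole system-environment interaction at gate `n`: the controlled rotation followed by the
controlled unitary, with the tensor factors put in order. -/
noncomputable def gate (C : Circuit I O S M K X N) (n : ℕ) :
    Matrix (I (n + 1) × Env S M K (n + 1))
      (O n × (Env S M K n × (S (n + 1) × X (n + 1)))) ℂ :=
  (C.controlledUnitary n *
      ((1 : Matrix (O n × X (n + 1)) (O n × X (n + 1)) ℂ) ⊗ₖ C.controlledRotation n)).submatrix
    (fun x : I (n + 1) × (Env S M K n × (S (n + 1) × (M (n + 1) × K (n + 1)))) =>
      ((x.1, x.2.2.2), (x.2.1, x.2.2.1)))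
    (fun y => ((y.1, y.2.2.2), (y.2.1, y.2.2.1)))

/-- The Choi matrix of `gate n`, with the incoming environment as first tensor factor and the
outgoing one as last. -/
noncomputable def gateChoi (C : Circuit I O S M K X N) (n : ℕ) :
    Matrix ((Env S M K n × (S (n + 1) × X (n + 1))) × ((O n × I (n + 1)) × Env S M K (n + 1)))
      ((Env S M K n × (S (n + 1) × X (n + 1))) × ((O n × I (n + 1)) × Env S M K (n + 1))) ℂ :=
  (choi (C.gate n)).submatrix
    (fun x => ((x.2.1.1, x.1), (x.2.1.2, x.2.2))) (fun x => ((x.2.1.1, x.1), (x.2.1.2, x.2.2)))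

open scoped Classical in
/-- The Choi matrix of the circuit up to gate `n`, with the environment still present. After the
preparation (`n = 0`) and after each gate the environment undergoes the measurement `r n`. -/
noncomputable def openComb (C : Circuit I O S M K X N) (r : ∀ n, Setoid (Env S M K n)) :
    ∀ n, Matrix (Sites I O n × Env S M K n) (Sites I O n × Env S M K n) ℂ
  | 0 => measure (A := I 0) (E := S 0) (r 0) C.init
  | n + 1 =>
    measure (A := Sites I O n × (O n × I (n + 1))) (r (n + 1))
      ((link
        ((C.openComb r n ⊗ₖ
            Matrix.single (C.zS n, C.zX n) (C.zS n, C.zX n) (1 : ℂ)).submatrix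
          (Equiv.prodAssoc _ _ _).symm (Equiv.prodAssoc _ _ _).symm)
        (C.gateChoi n)).submatrix (Equiv.prodAssoc _ _ _) (Equiv.prodAssoc _ _ _))

/-- The process matrix of the circuit: the environment is traced out after the last gate. -/
noncomputable def processMatrix (C : Circuit I O S M K X N) (r : ∀ n, Setoid (Env S M K n)) :
    Matrix (Sites I O N) (Sites I O N) ℂ :=
  Matrix.of fun x y => ∑ e : Env S M K N, C.openComb r N (x, e) (y, e)

open scoped Classical in
/-- The circuit `C` is the one that belongs to the classical-memory data `D`. -/
structure Realizes (C : Circuit I O S M K X N) (D : ClassicalMemory I O S M N) : Prop where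
  /-- the initial state is `∑ₛ p(s) ρ_s ⊗ |s⟩⟨s|` -/
  init_eq : C.init = ∑ s, ((D.p₀ s : ℂ) • D.ρ s) ⊗ₖ Matrix.single s s (1 : ℂ)
  /-- the rotation maps the fresh basis state to `∑ₛ √p(s|h) |s⟩` -/
  R_eq : ∀ n < N, ∀ h s, C.R n h s (C.zS n) = (Real.sqrt (D.p n h s) : ℂ)
  /-- the unitary on the system is controlled by the register `S (n + 1)` alone -/
  U_setting : ∀ n < N, ∀ h h' s, C.U n h s = C.U n h' s
  /-- `U n h s`, applied to the fresh register and followed by the projection `1 ⊗ |m⟩⟨m|` and the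
  trace over the registers, is the map of outcome `m` of the instrument with setting `s` -/
  U_dilates : ∀ n < N, ∀ h s m, ∀ o o' : O n, ∀ i i' : I (n + 1),
    ∑ k, C.U n h s (i, m, k) (o, C.zX n) * star (C.U n h s (i', m, k) (o', C.zX n)) =
      D.T n s m (o, i) (o', i')

end Circuit

/-- `W` is the process matrix of some circuit of nested controlled unitaries with `N` gates, with
some choice of measurements on the environment. -/
def IsCircuitProcess (I O : ℕ → Type) [∀ n, Fintype (I n)] [∀ n, Fintype (O n)] (N : ℕ)
    (W : Matrix (Sites I O N) (Sites I O N) ℂ) : Prop :=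
  ∃ (S M K X : ℕ → Type) (_ : ∀ n, Fintype (S n)) (_ : ∀ n, Fintype (M n))
    (_ : ∀ n, Fintype (K n)) (_ : ∀ n, Fintype (X n))
    (_ : ∀ n, Nonempty (S n)) (_ : ∀ n, Nonempty (M n))
    (C : Circuit I O S M K X N) (r : ∀ n, Setoid (Env S M K n)), C.processMatrix r = W

end ClassicalMemoryProcess

/-!
Tracing out the environment, like measuring it in its basis, only sees the diagonal blocks of the
state with respect to that basis, and each gate maps diagonal blocks to diagonal blocks: the block
with record `h` acquires the factor `|⟨s|R_h|0⟩|²` and the Choi matrix of a Kraus operator of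
`U_{h,s}`. The process matrix of a circuit is therefore a sum over classical records, whatever is
measured. By Stinespring's theorem every classical-memory process is of this form. Conversely, if
each setting carries the whole record so far, instruments that depend on the record become
instruments that depend on the setting alone, which is a classical-memory process.
-/

namespace ClassicalMemoryProcess

open Matrix

/-! ### Unitary matrices between differently labelled spaces -/

section Unitary

variable {A A' B B' C J R : Type*}

theorem sum_conjTranspose_mul_submatrix_prodMk [NonUnitalNonAssocSemiring R] [StarRing R]
    [Fintype B] [Fintype J] (V : Matrix (B × J) A R) :
    ∑ j, (V.submatrix (·, j) id)ᴴ * V.submatrix (·, j) id = Vᴴ * V := by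
  ext a a'
  simp only [Matrix.sum_apply, mul_apply, Fintype.sum_prod_type_right, conjTranspose_apply,
    submatrix_apply, id]

/-- A unitary from `A` to `B`, two coordinate spaces whose bases may carry different labels;
`Matrix.unitaryGroup` is the case `A = B`. -/
structure IsUnitary [Fintype A] [Fintype B] [DecidableEq A] [DecidableEq B]
    [NonAssocSemiring R] [StarRing R] (V : Matrix B A R) : Prop where
  conjTranspose_mul_self : Vᴴ * V = 1
  mul_conjTranspose_self : V * Vᴴ = 1

variable [Fintype A] [Fintype B] [Fintype C] [DecidableEq A] [DecidableEq B] [DecidableEq C]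

theorem isUnitary_one [NonAssocSemiring R] [StarRing R] : IsUnitary (1 : Matrix A A R) :=
  ⟨by simp, by simp⟩

theorem IsUnitary.mul [Semiring R] [StarRing R] {V : Matrix B A R} {W : Matrix C B R}
    (hW : IsUnitary W) (hV : IsUnitary V) : IsUnitary (W * V) where
  conjTranspose_mul_self := by
    rw [conjTranspose_mul, Matrix.mul_assoc, ← Matrix.mul_assoc Wᴴ, hW.conjTranspose_mul_self,
      Matrix.one_mul, hV.conjTranspose_mul_self]
  mul_conjTranspose_self := by
    rw [conjTranspose_mul, Matrix.mul_assoc, ← Matrix.mul_assoc V, hV.mul_conjTranspose_self,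
      Matrix.one_mul, hW.mul_conjTranspose_self]

theorem IsUnitary.submatrix_equiv [NonAssocSemiring R] [StarRing R] [Fintype A'] [Fintype B']
    [DecidableEq A'] [DecidableEq B'] {V : Matrix B A R} (hV : IsUnitary V) (f : B' ≃ B)
    (g : A' ≃ A) : IsUnitary (V.submatrix f g) where
  conjTranspose_mul_self := by
    rw [conjTranspose_submatrix, submatrix_mul_equiv, hV.conjTranspose_mul_self,
      submatrix_one_equiv]
  mul_conjTranspose_self := by
    rw [conjTranspose_submatrix, submatrix_mul_equiv, hV.mul_conjTranspose_self,
      submatrix_one_equiv]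

theorem IsUnitary.kronecker [CommSemiring R] [StarRing R] [Fintype A'] [Fintype B']
    [DecidableEq A'] [DecidableEq B'] {V : Matrix B A R} {W : Matrix B' A' R}
    (hV : IsUnitary V) (hW : IsUnitary W) : IsUnitary (V ⊗ₖ W) where
  conjTranspose_mul_self := by
    rw [conjTranspose_kronecker, ← mul_kronecker_mul, hV.conjTranspose_mul_self,
      hW.conjTranspose_mul_self, one_kronecker_one]
  mul_conjTranspose_self := by
    rw [conjTranspose_kronecker, ← mul_kronecker_mul, hV.mul_conjTranspose_self,
      hW.mul_conjTranspose_self, one_kronecker_one]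

theorem isUnitary_blockDiagonal [NonAssocSemiring R] [StarRing R] {V : C → Matrix B A R}
    (hV : ∀ c, IsUnitary (V c)) : IsUnitary (blockDiagonal V) where
  conjTranspose_mul_self := by
    rw [blockDiagonal_conjTranspose, ← blockDiagonal_mul, ← blockDiagonal_one]
    exact congrArg blockDiagonal (funext fun c => (hV c).conjTranspose_mul_self)
  mul_conjTranspose_self := by
    rw [blockDiagonal_conjTranspose, ← blockDiagonal_mul, ← blockDiagonal_one]
    exact congrArg blockDiagonal (funext fun c => (hV c).mul_conjTranspose_self)

theorem exists_isUnitary_submatrix_eq [RCLike R] [DecidableEq A']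
    (hcard : Fintype.card B = Fintype.card A) {V : Matrix B A' R} (hV : Vᴴ * V = 1)
    {f : A' → A} (hf : f.Injective) :
    ∃ U : Matrix B A R, IsUnitary U ∧ U.submatrix id f = V := by
  let column (a : A') : EuclideanSpace R B := WithLp.toLp 2 (Vᵀ a)
  have column_orthonormal : Orthonormal R column := by
    refine orthonormal_iff_ite.mpr fun a a' => ?_
    simpa [column, PiLp.inner_apply, mul_apply, one_apply, mul_comm] using congrFun₂ hV a a'
  have restrict_eq : (Set.range f).domRestrict (Function.extend f column 0) =
      column ∘ (Equiv.ofInjective f hf).symm := by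
    rw [Equiv.eq_comp_symm]
    exact funext fun a => hf.extend_apply column 0 a
  have orthonormal_range :
      Orthonormal R ((Set.range f).domRestrict (Function.extend f column 0)) :=
    restrict_eq ▸ column_orthonormal.comp _ (Equiv.injective _)
  obtain ⟨basis, hbasis⟩ := orthonormal_range.exists_orthonormalBasis_extension_of_card_eq
    (by rw [finrank_euclideanSpace, hcard])
  let U : Matrix B A R := of fun b a => basis a b
  have hU : Uᴴ * U = 1 := by
    ext a a'
    simpa [U, mul_apply, PiLp.inner_apply, one_apply, mul_comm] using
      orthonormal_iff_ite.mp basis.orthonormal a a'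
  refine ⟨U, ⟨hU, (mul_eq_one_comm_of_card_eq (m := A) (n := B) (R := R) hcard.symm).mp hU⟩, ?_⟩
  ext b a
  simp [U, column, hbasis (f a) ⟨a, rfl⟩, hf.extend_apply]

theorem exists_isUnitary_apply_eq_sqrt (z : A) {p : A → ℝ} (hp : ∀ a, 0 ≤ p a)
    (hsum : ∑ a, p a = 1) :
    ∃ U : Matrix A A ℂ, IsUnitary U ∧ ∀ a, U a z = (Real.sqrt (p a) : ℂ) := by
  let V : Matrix A Unit ℂ := of fun a _ => (Real.sqrt (p a) : ℂ)
  have hV : Vᴴ * V = 1 := by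
    have sqrt_mul_sqrt (a : A) : (Real.sqrt (p a) : ℂ) * Real.sqrt (p a) = p a := by
      rw [← Complex.ofReal_mul, Real.mul_self_sqrt (hp a)]
    ext
    simp [V, mul_apply, sqrt_mul_sqrt, ← Complex.ofReal_sum, hsum]
  obtain ⟨U, hU, hUV⟩ := exists_isUnitary_submatrix_eq rfl hV (f := fun _ => z)
    (Function.injective_of_subsingleton _)
  exact ⟨U, hU, fun a => congrFun₂ hUV a ()⟩

end Unitary

/-! ### States -/

section State

variable {A E R : Type*}

theorem sum_trace_blockDiag [Fintype A] [Fintype E] [AddCommMonoid R]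
    (P : Matrix (A × E) (A × E) R) : ∑ e, (blockDiag P e).trace = P.trace :=
  (Fintype.sum_prod_type_right (fun x => P x x)).symm

theorem posSemidef_blockDiag [Ring R] [PartialOrder R] [StarRing R]
    {P : Matrix (A × E) (A × E) R} (hP : P.PosSemidef) (e : E) : (blockDiag P e).PosSemidef :=
  hP.submatrix (·, e)

variable [Fintype A] [Fintype E] [RCLike R]

open scoped Classical in
/-- The state of `A` after the result `e` of a measurement of `E` in its basis. If `e` has
probability `0`, it is set to the reduced state of `A`, which is again a density matrix. -/
noncomputable def conditionalState (P : Matrix (A × E) (A × E) R) (e : E) : Matrix A A R :=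
  if (blockDiag P e).trace = 0 then ∑ e', blockDiag P e'
  else (blockDiag P e).trace⁻¹ • blockDiag P e

theorem conditionalState_posSemidef {P : Matrix (A × E) (A × E) R} (hP : P.PosSemidef) (e : E) :
    (conditionalState P e).PosSemidef := by
  unfold conditionalState
  split_ifs
  · exact posSemidef_sum _ fun e' _ => posSemidef_blockDiag hP e'
  · have h := posSemidef_blockDiag hP e
    exact h.smul (inv_nonneg.mpr h.trace_nonneg)

theorem conditionalState_trace {P : Matrix (A × E) (A × E) R} (hP : P.trace = 1) (e : E) :
    (conditionalState P e).trace = 1 := by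
  unfold conditionalState
  split_ifs with h
  · rw [trace_sum, sum_trace_blockDiag, hP]
  · rw [trace_smul, smul_eq_mul, inv_mul_cancel₀ h]

theorem trace_smul_conditionalState {P : Matrix (A × E) (A × E) R} (hP : P.PosSemidef) (e : E) :
    (blockDiag P e).trace • conditionalState P e = blockDiag P e := by
  unfold conditionalState
  split_ifs with h
  · rw [h, zero_smul, (posSemidef_blockDiag hP e).trace_eq_zero_iff.mp h]
  · rw [smul_smul, mul_inv_cancel₀ h, one_smul]

end State

/-! ### Instruments -/

section Instrument

variable {A B J X M K : Type}

theorem choi_posSemidef [Finite A] [Finite B] (V : Matrix B A ℂ) : (choi V).PosSemidef :=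
  posSemidef_vecMulVec_self_star fun x : A × B => V x.2 x.1

theorem sum_choi_apply_prodMk [Fintype B] (V : Matrix B A ℂ) (a a' : A) :
    ∑ b, choi V (a, b) (a', b) = (Vᴴ * V) a' a := by
  simp only [choi, of_apply, mul_apply, conjTranspose_apply, mul_comm]

open scoped MatrixOrder in
/-- The columns of a square root of `T` are Kraus operators. -/
theorem exists_sum_choi_eq [Fintype A] [Fintype B] {T : Matrix (A × B) (A × B) ℂ}
    (hT : T.PosSemidef) : ∃ V : A × B → Matrix B A ℂ, ∑ k, choi (V k) = T := by
  classical
  obtain ⟨Q, rfl⟩ := CStarAlgebra.nonneg_iff_eq_star_mul_self.mp hT.nonneg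
  refine ⟨fun k => of fun b a => star (Q k (a, b)), ?_⟩
  ext x y
  simp [Matrix.sum_apply, choi, mul_apply, star_eq_conjTranspose]

/-- The Choi matrix of `σ ↦ Tr_{MK} [(1 ⊗ |m⟩⟨m|) U (σ ⊗ |z⟩⟨z|) U†]`, for `U` from `A ⊗ X` to
`B ⊗ M ⊗ K`: outcome `m` of the instrument implemented by `U` on a fresh register in state `z`. -/
noncomputable def instrument [Fintype K] (U : Matrix (B × (M × K)) (A × X) ℂ) (z : X) (m : M) :
    Matrix (A × B) (A × B) ℂ :=
  ∑ k, choi (U.submatrix (·, m, k) (·, z))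

theorem instrument_posSemidef [Finite A] [Finite B] [Fintype K] (U : Matrix (B × (M × K)) (A × X) ℂ)
    (z : X) (m : M) : (instrument U z m).PosSemidef :=
  posSemidef_sum _ fun _ _ => choi_posSemidef _

theorem sum_instrument_apply_prodMk [Fintype B] [Fintype M] [Fintype K]
    (U : Matrix (B × (M × K)) (A × X) ℂ) (z : X) (a a' : A) :
    ∑ m, ∑ b, instrument U z m (a, b) (a', b) = (Uᴴ * U) (a', z) (a, z) := by
  simp only [instrument, Matrix.sum_apply]
  simp_rw [Finset.sum_comm (γ := B), sum_choi_apply_prodMk]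
  simp only [mul_apply, Fintype.sum_prod_type, conjTranspose_apply, submatrix_apply]
  rw [Finset.sum_comm (γ := B)]
  simp_rw [Finset.sum_comm (γ := B)]

/-- Stinespring dilation: the Kraus operators of all outcomes are stacked into one isometry, which
is extended to a unitary. The size of `X` only makes the dimensions match. -/
theorem exists_isUnitary_instrument_eq [Fintype A] [Fintype B] [Fintype M] [DecidableEq A]
    [DecidableEq B] [DecidableEq M] (z : B × (M × B)) {T : M → Matrix (A × B) (A × B) ℂ}
    (hT : ∀ m, (T m).PosSemidef)
    (hsum : ∀ a a', ∑ m, ∑ b, T m (a, b) (a', b) = if a = a' then 1 else 0) :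
    ∃ U : Matrix (B × (M × (A × B))) (A × (B × (M × B))) ℂ,
      IsUnitary U ∧ instrument U z = T := by
  choose V hV using fun m => exists_sum_choi_eq (hT m)
  let W : Matrix (B × (M × (A × B))) A ℂ := of fun x a => V x.2.1 x.2.2 x.1 a
  have hW : Wᴴ * W = 1 := by
    ext a a'
    calc (Wᴴ * W) a a' = ∑ m, ∑ k, ((V m k)ᴴ * V m k) a a' := by
          rw [← sum_conjTranspose_mul_submatrix_prodMk, Matrix.sum_apply, Fintype.sum_prod_type]
          rfl
      _ = ∑ m, ∑ b, T m (a', b) (a, b) := by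
          simp_rw [← hV, Matrix.sum_apply, Finset.sum_comm (γ := B), sum_choi_apply_prodMk]
      _ = (1 : Matrix A A ℂ) a a' := by
          rw [hsum, one_apply]
          simp only [eq_comm]
  obtain ⟨U, hU, hUW⟩ := exists_isUnitary_submatrix_eq
    (by simp only [Fintype.card_prod]; ring) hW (Prod.mk_left_injective z)
  refine ⟨U, hU, funext fun m => ?_⟩
  rw [← hV, instrument]
  refine Finset.sum_congr rfl fun k _ => congrArg choi ?_
  ext b a
  exact congrFun₂ hUW (b, m, k) a

end Instrument

/-! ### Branches of a circuit -/

theorem sum_kronecker {A A' B B' ι R : Type*} [NonUnitalNonAssocSemiring R] (t : Finset ι)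
    (P : ι → Matrix A A' R) (Q : Matrix B B' R) : (∑ a ∈ t, P a) ⊗ₖ Q = ∑ a ∈ t, P a ⊗ₖ Q := by
  ext
  simp only [kroneckerMap_apply, Matrix.sum_apply, Finset.sum_mul]

theorem kronecker_sum {A A' B B' ι R : Type*} [NonUnitalNonAssocSemiring R] (t : Finset ι)
    (P : Matrix A A' R) (Q : ι → Matrix B B' R) : P ⊗ₖ (∑ a ∈ t, Q a) = ∑ a ∈ t, P ⊗ₖ Q a := by
  ext
  simp only [kroneckerMap_apply, Matrix.sum_apply, Finset.mul_sum]

theorem blockDiagonal_mul_one_kronecker_apply {A B C C' R : Type*} [Fintype A] [Fintype C]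
    [DecidableEq A] [DecidableEq C] [NonAssocSemiring R] (V : C → Matrix B A R) (Q : Matrix C C' R)
    (b : B) (c : C) (a : A) (c' : C') :
    (blockDiagonal V * ((1 : Matrix A A R) ⊗ₖ Q)) (b, c) (a, c') = V c b a * Q c c' := by
  simp [mul_apply, Fintype.sum_prod_type, blockDiagonal_apply, one_apply]

theorem blockDiag_measure {A E : Type} (r : Setoid E) (P : Matrix (A × E) (A × E) ℂ) :
    blockDiag (measure r P) = blockDiag P := by
  ext e x y
  exact if_pos (r.refl e)

theorem link_kronecker_single {A B E Z : Type} [Fintype E] [Fintype Z] [DecidableEq Z]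
    (P : Matrix (A × E) (A × E) ℂ) (z : Z) (Q : Matrix ((E × Z) × B) ((E × Z) × B) ℂ) :
    link ((P ⊗ₖ single z z (1 : ℂ)).submatrix (Equiv.prodAssoc A E Z).symm
        (Equiv.prodAssoc A E Z).symm) Q =
      link P (Q.submatrix (Prod.map (·, z) id) (Prod.map (·, z) id)) := by
  ext x y
  simp [link, Fintype.sum_prod_type, single_apply, ite_and]

theorem sum_prodMap_eq {A A' B B' V : Type*} [Fintype A] [Fintype B] [DecidableEq A']
    [DecidableEq B'] [DecidableEq (A' × B')] [AddCommMonoid V] (f : A → A')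
    (g : B → B') (F : A × B → V) (c : A' × B') :
    ∑ x with Prod.map f g x = c, F x = ∑ a with f a = c.1, ∑ b with g b = c.2, F (a, b) := by
  simp only [Finset.sum_filter, Fintype.sum_prod_type, Prod.ext_iff, Prod.map_fst, Prod.map_snd,
    ite_and, Finset.sum_ite_irrel, Finset.sum_const_zero]

theorem sum_env_hist_eq {S M K : ℕ → Type} [∀ n, Fintype (S n)] [∀ n, Fintype (M n)]
    [∀ n, Fintype (K n)] [∀ n, DecidableEq (Hist S M n)] {V : Type*} [AddCommMonoid V] {n : ℕ}
    (f : Env S M K (n + 1) → V) (h : Hist S M (n + 1)) :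
    ∑ e : Env S M K (n + 1) with e.hist = h, f e =
      ∑ e : Env S M K n with e.hist = h.1, ∑ k, f (e, h.2.1, h.2.2, k) := by
  classical
  -- Unlike the instance derived from the factors, this one agrees with the statement.
  let : DecidableEq (Hist S M n × (S (n + 1) × M (n + 1))) :=
    ‹∀ n, DecidableEq (Hist S M n)› (n + 1)
  let setting_outcome (x : S (n + 1) × (M (n + 1) × K (n + 1))) := (x.1, x.2.1)
  refine (sum_prodMap_eq (Env.hist (n := n)) setting_outcome f h).trans ?_
  refine Finset.sum_congr rfl fun e _ => ?_
  simp only [setting_outcome, Finset.sum_filter, Prod.ext_iff, ite_and, Fintype.sum_prod_type,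
    Finset.sum_ite_irrel, Finset.sum_const_zero, Finset.sum_ite_eq', Finset.mem_univ, if_true]
  rw [Finset.sum_comm]
  simp only [Finset.sum_ite_eq', Finset.mem_univ, if_true]

namespace Circuit

variable {I O S M K X : ℕ → Type} [∀ n, Fintype (I n)] [∀ n, Fintype (O n)]
  [∀ n, Fintype (S n)] [∀ n, Fintype (M n)] [∀ n, Fintype (K n)] [∀ n, Fintype (X n)] {N : ℕ}

open scoped Classical in
theorem gate_apply (C : Circuit I O S M K X N) (n : ℕ) (i : I (n + 1)) (e e' : Env S M K n)
    (s s' : S (n + 1)) (m : M (n + 1)) (k : K (n + 1)) (o : O n) (x : X (n + 1)) :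
    C.gate n (i, (e, s, m, k)) (o, (e', s', x)) =
      if e = e' then C.U n e.hist s (i, m, k) (o, x) * C.R n e.hist s s' else 0 := by
  refine (blockDiagonal_mul_one_kronecker_apply _ _ (i, m, k) (e, s) (o, x) (e', s')).trans ?_
  simp [controlledRotation, blockDiagonal_apply]

/-- The probability with which the rotation selects the setting `s` after the record `h`. -/
noncomputable def settingProb (C : Circuit I O S M K X N) (n : ℕ) (h : Hist S M n)
    (s : S (n + 1)) : ℝ :=
  Complex.normSq (C.R n h s (C.zS n))

theorem blockDiag_openComb_succ (C : Circuit I O S M K X N) (r : ∀ n, Setoid (Env S M K n)) (n : ℕ)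
    (e : Env S M K n) (s : S (n + 1)) (m : M (n + 1)) (k : K (n + 1)) :
    blockDiag (C.openComb r (n + 1)) (e, s, m, k) =
      blockDiag (C.openComb r n) e ⊗ₖ ((C.settingProb n e.hist s : ℂ) •
        choi ((C.U n e.hist s).submatrix (·, m, k) (·, C.zX n))) := by
  classical
  refine (congrFun (blockDiag_measure (r (n + 1)) _) (e, s, m, k)).trans ?_
  rw [link_kronecker_single]
  ext ⟨x, o, i⟩ ⟨y, o', i'⟩
  calc _ = ∑ f, ∑ f', C.openComb r n (x, f) (y, f') *
        (C.gate n (i, (e, s, m, k)) (o, (f, C.zS n, C.zX n)) *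
          star (C.gate n (i', (e, s, m, k)) (o', (f', C.zS n, C.zX n)))) := rfl
    _ = _ := by
      simp only [gate_apply, apply_ite star, star_zero, mul_ite, ite_mul, mul_zero, zero_mul,
        Finset.sum_ite_eq, Finset.mem_univ, if_true, blockDiag_apply, kroneckerMap_apply,
        Matrix.smul_apply, smul_eq_mul, choi, of_apply, submatrix_apply, settingProb,
        Complex.normSq_eq_conj_mul_self, star_mul', starRingEnd_apply]
      ring

/-- The contribution of the record `h` to the process matrix of a circuit. -/
noncomputable def branch (C : Circuit I O S M K X N) :
    ∀ n, Hist S M n → Matrix (Sites I O n) (Sites I O n) ℂ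
  | 0, s => blockDiag C.init s
  | n + 1, (h, s, m) =>
    C.branch n h ⊗ₖ ((C.settingProb n h s : ℂ) • instrument (C.U n h s) (C.zX n) m)

open scoped Classical in
theorem sum_blockDiag_openComb_hist_eq (C : Circuit I O S M K X N)
    (r : ∀ n, Setoid (Env S M K n)) :
    ∀ n (h : Hist S M n),
      ∑ e : Env S M K n with e.hist = h, blockDiag (C.openComb r n) e = C.branch n h
  | 0, s => by
    refine (Finset.sum_eq_single_of_mem s ?_ ?_).trans (congrFun (blockDiag_measure (r 0) C.init) s)
    · exact Finset.mem_filter.mpr ⟨Finset.mem_univ _, rfl⟩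
    · exact fun e he hne => absurd (Finset.mem_filter.mp he).2 hne
  | n + 1, (h, s, m) => by
    refine (sum_env_hist_eq _ (h, s, m)).trans ?_
    calc _ = ∑ e : Env S M K n with e.hist = h, ∑ k, blockDiag (C.openComb r n) e ⊗ₖ
            ((C.settingProb n h s : ℂ) •
              choi ((C.U n h s).submatrix (·, m, k) (·, C.zX n))) := by
          refine Finset.sum_congr rfl fun e he => Finset.sum_congr rfl fun k _ => ?_
          rw [blockDiag_openComb_succ, (Finset.mem_filter.mp he).2]
      _ = C.branch n h ⊗ₖ
            ((C.settingProb n h s : ℂ) • instrument (C.U n h s) (C.zX n) m) := by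
          rw [← C.sum_blockDiag_openComb_hist_eq r n h, sum_kronecker]
          simp only [instrument, Finset.smul_sum, kronecker_sum]

theorem processMatrix_eq_sum_branch (C : Circuit I O S M K X N)
    (r : ∀ n, Setoid (Env S M K n)) : C.processMatrix r = ∑ h, C.branch N h := by
  classical
  calc C.processMatrix r = ∑ e, blockDiag (C.openComb r N) e := by
        ext x y
        simp only [processMatrix, of_apply, Matrix.sum_apply, blockDiag_apply]
    _ = ∑ h, ∑ e : Env S M K N with e.hist = h, blockDiag (C.openComb r N) e :=
        (Finset.sum_fiberwise _ _ _).symm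
    _ = ∑ h, C.branch N h :=
        Finset.sum_congr rfl fun h _ => C.sum_blockDiag_openComb_hist_eq r N h

end Circuit

/-! ### Unitarity of the gates -/

namespace Circuit

variable {I O S M K X : ℕ → Type} [∀ n, Fintype (I n)] [∀ n, Fintype (O n)]
  [∀ n, Fintype (S n)] [∀ n, Fintype (M n)] [∀ n, Fintype (K n)] [∀ n, Fintype (X n)] {N n : ℕ}

open scoped Classical in
theorem isUnitary_controlledRotation (C : Circuit I O S M K X N) (hn : n < N) :
    IsUnitary (C.controlledRotation n) :=
  (isUnitary_blockDiagonal fun e : Env S M K n =>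
      ⟨C.R_isometry n hn e.hist, C.R_coisometry n hn e.hist⟩).submatrix_equiv
    (Equiv.prodComm _ _) (Equiv.prodComm _ _)

open scoped Classical in
theorem isUnitary_controlledUnitary (C : Circuit I O S M K X N) (hn : n < N) :
    IsUnitary (C.controlledUnitary n) :=
  isUnitary_blockDiagonal fun c =>
    ⟨C.U_isometry n hn c.1.hist c.2, C.U_coisometry n hn c.1.hist c.2⟩

/-- The bijection of basis labels that puts the tensor factors of the outgoing space of a gate in
the order of `controlledUnitary`. -/
def outEquiv (I S M K : ℕ → Type) (n : ℕ) :
    I (n + 1) × Env S M K (n + 1) ≃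
      (I (n + 1) × (M (n + 1) × K (n + 1))) × (Env S M K n × S (n + 1)) where
  toFun := fun (i, (e, s, x)) => ((i, x), (e, s))
  invFun := fun ((i, x), (e, s)) => (i, (e, s, x))
  left_inv _ := rfl
  right_inv _ := rfl

/-- The bijection of basis labels that puts the tensor factors of the incoming space of a gate in
the order of `controlledUnitary`. -/
def inEquiv (O S M K X : ℕ → Type) (n : ℕ) :
    O n × (Env S M K n × (S (n + 1) × X (n + 1))) ≃
      (O n × X (n + 1)) × (Env S M K n × S (n + 1)) where
  toFun := fun (o, (e, s, x)) => ((o, x), (e, s))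
  invFun := fun ((o, x), (e, s)) => (o, (e, s, x))
  left_inv _ := rfl
  right_inv _ := rfl

open scoped Classical in
theorem isUnitary_gate (C : Circuit I O S M K X N) (hn : n < N) : IsUnitary (C.gate n) :=
  ((C.isUnitary_controlledUnitary hn).mul
      (isUnitary_one.kronecker (C.isUnitary_controlledRotation hn))).submatrix_equiv
    (outEquiv I S M K n) (inEquiv O S M K X n)

end Circuit

/-! ### Circuits from classical memory -/

section Realization

variable {I O S M K X : ℕ → Type} [∀ n, Fintype (I n)] [∀ n, Fintype (O n)]
  [∀ n, Fintype (S n)] [∀ n, Fintype (M n)] [∀ n, Fintype (K n)] [∀ n, Fintype (X n)] {N : ℕ}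

theorem blockDiag_sum_kronecker_single {A E R : Type*} [Fintype E] [DecidableEq E]
    [NonAssocSemiring R] (P : E → Matrix A A R) :
    blockDiag (∑ e, P e ⊗ₖ single e e (1 : R)) = P := by
  ext e x y
  simp [blockDiag_apply, Matrix.sum_apply, single_apply]

theorem posSemidef_kronecker_single {A E R : Type*} [Finite A] [Finite E] [DecidableEq E]
    [RCLike R] {P : Matrix A A R} (hP : P.PosSemidef) (e : E) :
    (P ⊗ₖ single e e (1 : R)).PosSemidef :=
  hP.kronecker (diagonal_single e (1 : R) ▸ .diagonal (Pi.single_nonneg.mpr zero_le_one))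

theorem Circuit.Realizes.branch_eq_term {C : Circuit I O S M K X N}
    {D : ClassicalMemory I O S M N} (hCD : C.Realizes D) :
    ∀ n ≤ N, ∀ h, C.branch n h = D.term n h
  | 0, _, s => by
    classical
    rw [Circuit.branch, hCD.init_eq]
    exact congrFun (blockDiag_sum_kronecker_single fun s => (D.p₀ s : ℂ) • D.ρ s) s
  | n + 1, hn, (h, s, m) => by
    have settingProb_eq : C.settingProb n h s = D.p n h s := by
      rw [Circuit.settingProb, hCD.R_eq n hn h s, Complex.normSq_ofReal,
        Real.mul_self_sqrt (D.p_nonneg n hn h s)]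
    have instrument_eq : instrument (C.U n h s) (C.zX n) m = D.T n s m := by
      ext ⟨o, i⟩ ⟨o', i'⟩
      rw [instrument, Matrix.sum_apply]
      exact hCD.U_dilates n hn h s m o o' i i'
    rw [Circuit.branch, ClassicalMemory.term, settingProb_eq, instrument_eq,
      hCD.branch_eq_term n (Nat.le_of_succ_le hn) h]

theorem Circuit.Realizes.processMatrix_eq {C : Circuit I O S M K X N}
    {D : ClassicalMemory I O S M N} (hCD : C.Realizes D) (r : ∀ n, Setoid (Env S M K n)) :
    C.processMatrix r = D.processMatrix :=
  (C.processMatrix_eq_sum_branch r).trans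
    (Finset.sum_congr rfl fun h _ => hCD.branch_eq_term N le_rfl h)

open scoped Classical in
/-- The state `∑ₛ p(s) ρ_s ⊗ |s⟩⟨s|` in which a circuit realizing the classical-memory data `D`
starts. -/
noncomputable def ClassicalMemory.initialState (D : ClassicalMemory I O S M N) :
    Matrix (I 0 × S 0) (I 0 × S 0) ℂ :=
  ∑ s, ((D.p₀ s : ℂ) • D.ρ s) ⊗ₖ single s s (1 : ℂ)

theorem ClassicalMemory.initialState_posSemidef (D : ClassicalMemory I O S M N) :
    D.initialState.PosSemidef := by
  classical
  exact posSemidef_sum _ fun s _ => posSemidef_kronecker_single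
    ((D.ρ_posSemidef s).smul (Complex.zero_le_real.mpr (D.p₀_nonneg s))) s

theorem ClassicalMemory.initialState_trace (D : ClassicalMemory I O S M N) :
    D.initialState.trace = 1 := by
  simp [initialState, trace_sum, trace_kronecker, D.ρ_trace, ← Complex.ofReal_sum, D.p₀_sum]

theorem ClassicalMemory.exists_circuit_realizes [∀ n, Nonempty (I n)] [∀ n, Nonempty (S n)]
    [∀ n, Nonempty (M n)] (D : ClassicalMemory I O S M N) :
    ∃ C : Circuit I O S M (fun n => O (n - 1) × I n) (fun n => I n × (M n × I n)) N,
      C.Realizes D := by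
  classical
  let zS (n) : S (n + 1) := Classical.arbitrary _
  let zX (n) : I (n + 1) × (M (n + 1) × I (n + 1)) := Classical.arbitrary _
  choose! R hR hR_sqrt using fun n (h : Hist S M n) (hn : n < N) =>
    exists_isUnitary_apply_eq_sqrt (zS n) (D.p_nonneg n hn h) (D.p_sum n hn h)
  choose! U hU hU_instrument using fun n s (hn : n < N) =>
    exists_isUnitary_instrument_eq (zX n) (D.T_posSemidef n hn s) (D.T_tracePreserving n hn s)
  let C : Circuit I O S M (fun n => O (n - 1) × I n) (fun n => I n × (M n × I n)) N :=
    { init := D.initialState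
      init_posSemidef := D.initialState_posSemidef
      init_trace := D.initialState_trace
      zS := zS
      zX := zX
      R := R
      R_isometry := fun n hn h => (hR n h hn).conjTranspose_mul_self
      R_coisometry := fun n hn h => (hR n h hn).mul_conjTranspose_self
      U := fun n _ s => U n s
      U_isometry := fun n hn _ s => by
        convert (hU n s hn).conjTranspose_mul_self <;> rfl
      U_coisometry := fun n hn _ s => by
        convert (hU n s hn).mul_conjTranspose_self <;> rfl }
  refine ⟨C, rfl, fun n hn h s => hR_sqrt n h hn s, fun _ _ _ _ _ => rfl, ?_⟩
  intro n hn _ s m o o' i i'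
  rw [← hU_instrument n s hn, instrument, Matrix.sum_apply]
  rfl

end Realization

/-! ### Classical memory from circuits -/

/-- Settings that carry the whole record of a circuit: a setting for the instrument of gate `n`
consists of the record before that gate and of the value of the control register `S (n + 1)`. -/
def RecordSetting (S M : ℕ → Type) : ℕ → Type
  | 0 => S 0
  | n + 1 => Hist S M n × S (n + 1)

section Record

variable {S M : ℕ → Type}

instance RecordSetting.instFintype [∀ n, Fintype (S n)] [∀ n, Fintype (M n)] :
    ∀ n, Fintype (RecordSetting S M n)
  | 0 => inferInstanceAs (Fintype (S 0))
  | n + 1 => inferInstanceAs (Fintype (Hist S M n × S (n + 1)))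

instance Hist.instNonempty [∀ n, Nonempty (S n)] [∀ n, Nonempty (M n)] :
    ∀ n, Nonempty (Hist S M n)
  | 0 => inferInstanceAs (Nonempty (S 0))
  | n + 1 =>
    haveI := Hist.instNonempty n
    inferInstanceAs (Nonempty (Hist S M n × (S (n + 1) × M (n + 1))))

instance RecordSetting.instNonempty [∀ n, Nonempty (S n)] [∀ n, Nonempty (M n)] :
    ∀ n, Nonempty (RecordSetting S M n)
  | 0 => inferInstanceAs (Nonempty (S 0))
  | n + 1 => inferInstanceAs (Nonempty (Hist S M n × S (n + 1)))

/-- The record that remains when each setting is reduced to the value of its control register. -/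
def Hist.forget : ∀ {n}, Hist (RecordSetting S M) M n → Hist S M n
  | 0, s => s
  | _ + 1, (h, (_, s), m) => (Hist.forget h, s, m)

theorem sum_hist_forget_eq [∀ n, Fintype (S n)] [∀ n, Fintype (M n)]
    [∀ n, DecidableEq (Hist S M n)] {V : Type*} [AddCommMonoid V] {n : ℕ}
    (f : Hist (RecordSetting S M) M (n + 1) → V) (h : Hist S M (n + 1)) :
    ∑ h' : Hist (RecordSetting S M) M (n + 1) with h'.forget = h, f h' =
      ∑ h' : Hist (RecordSetting S M) M n with h'.forget = h.1,
        ∑ g : Hist S M n, f (h', (g, h.2.1), h.2.2) := by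
  classical
  let : DecidableEq (Hist S M n × (S (n + 1) × M (n + 1))) :=
    ‹∀ n, DecidableEq (Hist S M n)› (n + 1)
  let setting_outcome (x : (Hist S M n × S (n + 1)) × M (n + 1)) := (x.1.2, x.2)
  refine (sum_prodMap_eq (Hist.forget (n := n)) setting_outcome f h).trans ?_
  refine Finset.sum_congr rfl fun h' _ => ?_
  simp only [setting_outcome, Finset.sum_filter, Prod.ext_iff, ite_and, Fintype.sum_prod_type,
    Finset.sum_ite_irrel, Finset.sum_const_zero, Finset.sum_ite_eq', Finset.mem_univ, if_true]
  rfl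

end Record

namespace Circuit

variable {I O S M K X : ℕ → Type} [∀ n, Fintype (I n)] [∀ n, Fintype (O n)]
  [∀ n, Fintype (S n)] [∀ n, Fintype (M n)] [∀ n, Fintype (K n)] [∀ n, Fintype (X n)] {N : ℕ}

theorem settingProb_sum (C : Circuit I O S M K X N) {n : ℕ} (hn : n < N) (h : Hist S M n) :
    ∑ s, C.settingProb n h s = 1 := by
  classical
  have column_norm := congrFun₂ (C.R_isometry n hn h) (C.zS n) (C.zS n)
  simp only [mul_apply, conjTranspose_apply, one_apply_eq] at column_norm
  rw [← Complex.ofReal_inj, Complex.ofReal_sum, Complex.ofReal_one, ← column_norm]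
  exact Finset.sum_congr rfl fun s _ => Complex.normSq_eq_conj_mul_self

open scoped Classical in
/-- The classical-memory data of a circuit. After the preparation and after each gate the control
and outcome registers are read out; each setting contains the record read out so far, so that the
unitaries, which depend on the record, become instruments that depend on the setting alone. -/
noncomputable def toClassicalMemory (C : Circuit I O S M K X N) :
    ClassicalMemory I O (RecordSetting S M) M N where
  p₀ := fun s : S 0 => (blockDiag C.init s).trace.re
  p₀_nonneg := fun s : S 0 =>
    (Complex.nonneg_iff.mp (posSemidef_blockDiag C.init_posSemidef s).trace_nonneg).1
  p₀_sum := by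
    have trace_eq := congrArg Complex.re ((sum_trace_blockDiag C.init).trans C.init_trace)
    rwa [Complex.re_sum, Complex.one_re] at trace_eq
  ρ := fun s : S 0 => conditionalState C.init s
  ρ_posSemidef := conditionalState_posSemidef C.init_posSemidef
  ρ_trace := conditionalState_trace C.init_trace
  p n h := fun (g, s) => if g = h.forget then C.settingProb n g s else 0
  p_nonneg := fun n _ h (g, s) => ite_nonneg (Complex.normSq_nonneg _) le_rfl
  p_sum n hn h := (Fintype.sum_prod_type _).trans (by simp [C.settingProb_sum hn])
  T n := fun (g, s) m => instrument (C.U n g s) (C.zX n) m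
  T_posSemidef _ _ _ _ := instrument_posSemidef _ _ _
  T_tracePreserving := fun n hn (g, s) o o' => by
    rw [sum_instrument_apply_prodMk, C.U_isometry n hn, one_apply]
    simp [eq_comm]

open scoped Classical in
theorem sum_toClassicalMemory_term_forget_eq (C : Circuit I O S M K X N) :
    ∀ n (h : Hist S M n),
      ∑ h' : Hist (RecordSetting S M) M n with h'.forget = h, C.toClassicalMemory.term n h' =
        C.branch n h
  | 0, s => by
    refine (Finset.sum_eq_single_of_mem s ?_ ?_).trans ?_
    · exact Finset.mem_filter.mpr ⟨Finset.mem_univ _, rfl⟩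
    · exact fun s' hs' hne => absurd (Finset.mem_filter.mp hs').2 hne
    · have trace_eq_re := Complex.eq_re_of_ofReal_le
        (posSemidef_blockDiag C.init_posSemidef s).trace_nonneg
      exact (congrArg (· • _) trace_eq_re.symm).trans
        (trace_smul_conditionalState C.init_posSemidef s)
  | n + 1, (h, s, m) => by
    refine (sum_hist_forget_eq _ (h, s, m)).trans ?_
    calc _ = ∑ h' : Hist (RecordSetting S M) M n with h'.forget = h,
            C.toClassicalMemory.term n h' ⊗ₖ
              ((C.settingProb n h s : ℂ) • instrument (C.U n h s) (C.zX n) m) := by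
          refine Finset.sum_congr rfl fun h' hh' => ?_
          obtain rfl := (Finset.mem_filter.mp hh').2
          refine (Fintype.sum_eq_single h'.forget fun g hg => ?_).trans ?_
          · simp only [ClassicalMemory.term, toClassicalMemory, if_neg hg, Complex.ofReal_zero,
              zero_smul, kronecker_zero]
            rfl
          · simp only [ClassicalMemory.term, toClassicalMemory, if_true]
      _ = C.branch n h ⊗ₖ
            ((C.settingProb n h s : ℂ) • instrument (C.U n h s) (C.zX n) m) := by
          rw [← C.sum_toClassicalMemory_term_forget_eq n h, sum_kronecker]

theorem toClassicalMemory_processMatrix (C : Circuit I O S M K X N)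
    (r : ∀ n, Setoid (Env S M K n)) : C.toClassicalMemory.processMatrix = C.processMatrix r := by
  classical
  rw [C.processMatrix_eq_sum_branch, ClassicalMemory.processMatrix,
    ← Finset.sum_fiberwise _ Hist.forget]
  exact Finset.sum_congr rfl fun h _ => C.sum_toClassicalMemory_term_forget_eq N h

end Circuit

end ClassicalMemoryProcess

open scoped Classical in
theorem mainTheorem4 (I O : ℕ → Type) [∀ n, Fintype (I n)] [∀ n, Fintype (O n)]
    [∀ n, Nonempty (I n)] [∀ n, Nonempty (O n)] (N : ℕ) :
    -- classical-memory processes are exactly the processes of circuits of controlled unitaries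
    (∀ W : Matrix (ClassicalMemoryProcess.Sites I O N) (ClassicalMemoryProcess.Sites I O N) ℂ,
      ClassicalMemoryProcess.IsClassicalMemory I O N W ↔
        ClassicalMemoryProcess.IsCircuitProcess I O N W) ∧
    -- given data are realized on their own registers, whatever is measured on the environment
    (∀ (S M : ℕ → Type) [∀ n, Fintype (S n)] [∀ n, Fintype (M n)]
      [∀ n, Nonempty (S n)] [∀ n, Nonempty (M n)]
      (D : ClassicalMemoryProcess.ClassicalMemory I O S M N),
      ∃ (K X : ℕ → Type) (_ : ∀ n, Fintype (K n)) (_ : ∀ n, Fintype (X n))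
        (C : ClassicalMemoryProcess.Circuit I O S M K X N), C.Realizes D ∧
        ∀ r : ∀ n, Setoid (ClassicalMemoryProcess.Env S M K n),
          C.processMatrix r = D.processMatrix) ∧
    -- the whole interaction at each gate is a unitary
    (∀ (S M K X : ℕ → Type) [∀ n, Fintype (S n)] [∀ n, Fintype (M n)]
      [∀ n, Fintype (K n)] [∀ n, Fintype (X n)]
      (C : ClassicalMemoryProcess.Circuit I O S M K X N), ∀ n < N,
      (C.gate n).conjTranspose * C.gate n = 1 ∧ C.gate n * (C.gate n).conjTranspose = 1) := by
  refine ⟨fun W => ⟨?_, ?_⟩, ?_, ?_⟩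
  · rintro ⟨S, M, _, _, _, _, D, rfl⟩
    obtain ⟨C, hCD⟩ := D.exists_circuit_realizes
    exact ⟨S, M, _, _, _, _, inferInstance, inferInstance, inferInstance, inferInstance, C,
      fun _ => ⊤, hCD.processMatrix_eq _⟩
  · rintro ⟨S, M, K, X, _, _, _, _, _, _, C, r, rfl⟩
    exact ⟨_, M, inferInstance, inferInstance, inferInstance, inferInstance, C.toClassicalMemory,
      C.toClassicalMemory_processMatrix r⟩
  · intro S M _ _ _ _ D
    obtain ⟨C, hCD⟩ := D.exists_circuit_realizes
    exact ⟨_, _, inferInstance, inferInstance, C, hCD, hCD.processMatrix_eq⟩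
  · intro S M K X _ _ _ _ C n hn
    exact ⟨(C.isUnitary_gate hn).conjTranspose_mul_self,
      (C.isUnitary_gate hn).mul_conjTranspose_self⟩
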